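/- Let $k$ be a finite field and let $Q$ be a finite quiver with vertex set $I$ whose underlying unoriented graph is a disjoint union of Dynkin diagrams of type $A_n$, $D_n$, $E_6$, $E_7$, $E_8$. For $d=(d_i)\in\mathbb N^I$ put $V=\bigoplus_i k^{d_i}$, $R_d=\bigoplus_{\alpha:i\to j}\mathrm{Hom}(k^{d_i},k^{d_j})$ and $G_d=\prod_i GL_{d_i}(k)$, acting on $R_d$ by $(g.M)_{\alpha:i\to j}=g_jM_\alpha g_i^{-1}$; write $\mathcal O_M=G_d.M$, and $\mathrm{Aut}(M)$ for the stabilizer of $M$. Let $I_1,\dots,I_\nu$ represent the isomorphism classes of indecomposable finite-dimensional $k$-representations of $Q$, each exactly once, ordered such that $\mathrm{Hom}_Q(I_s,I_t)=0$ for $1\le s<t\le\nu$. Let $M,N\in R_d$, and let $N=\bigoplus_{s=1}^\nu N_s$ be a decomposition into subrepresentations such that $N_s$ is isomorphic to a direct sum of copies of $I_s$. Let $V=\bigoplus_s V^s$ be the underlying decomposition of $I$-graded vector spaces, put $F_0^s=\bigoplus_{t>s}V^t$ for $0\le s\le\nu$, and let $R_d=\bigoplus_{s,t}\bigoplus_{\alpha:i\to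 j}\mathrm{Hom}((V^s)_i,(V^t)_j)$ be the induced decomposition of $R_d$ into blocks indexed by the pairs $(s,t)$. Let $Y_N\subset R_d$ be the affine subspace of all $X$ such that $X_\alpha((F_0^s)_i)\subset (F_0^s)_j$ for all arrows $\alpha:i\to j$ and all $s$, and such that $X$ induces on each $F_0^{s-1}/F_0^s=V^s$ the representation $N_s$; regard $Y_N$ as a vector space with origin $N$. Let $\mathfrak u\subset\bigoplus_i\mathfrak{gl}(k^{d_i})$ be the Lie algebra of the unipotent radical of the stabilizer of the flag $F_0^*$ in $G_d$, i.e. $\mathfrak u=\{\xi : \xi(F_0^{s-1})\subset F_0^{s},\ 1\le s\le\nu\}$, and let $\phi(\xi)_{\alpha:i\to j}=\xi_jN_\alpha-N_\alpha\xi_i$. Let $E_N=N+E\subset Y_N$, where $E$ is any complement of $\phi(\mathfrak u)$ in $\{x : N+x\in Y_N\}$ which is the direct sum of its intersections with the blocks of $R_d$. Let $\mathcal F^M_{N_\nu,\dots,N_1}$ be the set of filtrations $0=M^\nu\subset\dots\subset M^1\subset M^0=M$ of $M$ by subrepresentations such that $M^{s-1}/M^s\cong N_s$ for $1\le s\le\nu$.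 Then this set is finite and $$|\mathcal F^M_{N_\nu,\dots,N_1}|=\frac{|\mathrm{Aut}(M)|\cdot|E_N\cap\mathcal O_M|}{\prod_{s=1}^\nu|\mathrm{Aut}(N_s)|}.$$ -/

import Mathlib

universe u v w w₁ w₂ x

/-! ### Dynkin quivers -/

/-- The symmetric matrix `2 δ_{ij} - #{arrows i → j} - #{arrows j → i}`; it encodes the underlying
unoriented (multi)graph of the quiver. -/
noncomputable def quiverCartan (I : Type u) [Quiver.{v} I] : Matrix I I ℤ :=
  open Classical in
  Matrix.of fun i j =>
    (if i = j then 2 else 0) - (Nat.card (i ⟶ j) : ℤ) - (Nat.card (j ⟶ i) : ℤ)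

/-- The Cartan matrices of the (nonempty) diagrams `A_n`, `D_n` (`n ≥ 4`), `E_6`, `E_7`, `E_8`. -/
def IsADECartan (n : ℕ) (C : Matrix (Fin n) (Fin n) ℤ) : Prop :=
  (1 ≤ n ∧ C = CartanMatrix.A n) ∨ (4 ≤ n ∧ C = CartanMatrix.D n) ∨
  (∃ e : Fin n ≃ Fin 6, C = CartanMatrix.E₆.submatrix e e) ∨
  (∃ e : Fin n ≃ Fin 7, C = CartanMatrix.E₇.submatrix e e) ∨
  (∃ e : Fin n ≃ Fin 8, C = CartanMatrix.E₈.submatrix e e)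

/-- A finite quiver whose underlying unoriented graph is a disjoint union of Dynkin diagrams of
type `A_n`, `D_n`, `E_6`, `E_7` or `E_8`. -/
def IsDynkinQuiver (I : Type u) [Quiver.{v} I] : Prop :=
  (∀ i j : I, Finite (i ⟶ j)) ∧
  ∃ (c : ℕ) (n : Fin c → ℕ) (T : ∀ a, Matrix (Fin (n a)) (Fin (n a)) ℤ)
    (e : I ≃ (Σ a, Fin (n a))),
    (∀ a, IsADECartan (n a) (T a)) ∧
    quiverCartan I = (Matrix.blockDiagonal' T).submatrix e e

/-! ### Representations of a quiver -/

/-- Representations of the quiver on a fixed `I`-graded vector space `V = ⊕_i V_i`, that is, the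
vector space `⊕_{α : i → j} Hom(V_i, V_j)`. -/
def QRep {I : Type u} [Quiver.{v} I] (k : Type w) [Field k] (V : I → Type x)
    [∀ i, AddCommGroup (V i)] [∀ i, Module k (V i)] : Type _ :=
  ∀ ⦃i j : I⦄, (i ⟶ j) → (V i →ₗ[k] V j)

/-- The graded vector space `⊕_i k^{d_i}`. -/
abbrev StdSpace {I : Type u} (k : Type w) (d : I → ℕ) : I → Type w := fun i => Fin (d i) → k

/-- The representation variety `R_d = ⊕_{α : i → j} Hom(k^{d_i}, k^{d_j})`. -/
abbrev RepVar {I : Type u} [Quiver.{v} I] (k : Type w) [Field k] (d : I → ℕ) : Type _ :=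
  QRep k (StdSpace k d)

namespace QRep

variable {I : Type u} [Quiver.{v} I] {k : Type w} [Field k]
variable {V : I → Type x} [∀ i, AddCommGroup (V i)] [∀ i, Module k (V i)]
variable {V₁ : I → Type w₁} [∀ i, AddCommGroup (V₁ i)] [∀ i, Module k (V₁ i)]
variable {V₂ : I → Type w₂} [∀ i, AddCommGroup (V₂ i)] [∀ i, Module k (V₂ i)]

instance : AddCommGroup (QRep k V) :=
  inferInstanceAs (AddCommGroup (∀ i j : I, (i ⟶ j) → (V i →ₗ[k] V j)))

instance : Module k (QRep k V) :=
  inferInstanceAs (Module k (∀ i j : I, (i ⟶ j) → (V i →ₗ[k] V j)))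

/-- The group `G = ∏_i GL(V_i)` acts by `(g.M)_α = g_j M_α g_i⁻¹` for `α : i → j`. -/
instance : MulAction (∀ i, V i ≃ₗ[k] V i) (QRep k V) where
  smul g M := fun i j α => (g j).toLinearMap ∘ₗ M α ∘ₗ ((g i)⁻¹ : V i ≃ₗ[k] V i).toLinearMap
  one_smul _ := rfl
  mul_smul _ _ _ := rfl

/-- The orbit `O_M ⊆ QRep k V` under `G = ∏_i GL(V_i)`. -/
def orbit (M : QRep k V) : Set (QRep k V) := MulAction.orbit (∀ i, V i ≃ₗ[k] V i) M

/-- `Aut(M)`, the stabilizer of `M` in `G = ∏_i GL(V_i)`. -/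
def Aut (M : QRep k V) : Subgroup (∀ i, V i ≃ₗ[k] V i) :=
  MulAction.stabilizer (∀ i, V i ≃ₗ[k] V i) M

/-- A family of linear maps is a morphism of representations. -/
def IsHom (X : QRep k V₁) (Y : QRep k V₂) (f : ∀ i, V₁ i →ₗ[k] V₂ i) : Prop :=
  ∀ ⦃i j : I⦄ (α : i ⟶ j), f j ∘ₗ X α = Y α ∘ₗ f i

/-- `Hom_Q(X, Y) = 0`. -/
def HomZero (X : QRep k V₁) (Y : QRep k V₂) : Prop :=
  ∀ f : ∀ i, V₁ i →ₗ[k] V₂ i, IsHom X Y f → ∀ i, f i = 0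

/-- `X` and `Y` are isomorphic representations. -/
def IsIso (X : QRep k V₁) (Y : QRep k V₂) : Prop :=
  ∃ f : ∀ i, V₁ i ≃ₗ[k] V₂ i, IsHom X Y fun i => (f i).toLinearMap

/-- The direct sum of `n` copies of `X`. -/
def power (X : QRep k V) (n : ℕ) : QRep k (fun i => Fin n → V i) :=
  fun _ _ α => (X α).compLeft (Fin n)

/-- A subrepresentation of `X`. -/
structure Subrep (X : QRep k V) where
  /-- its component at each vertex -/
  carrier : ∀ i, Submodule k (V i)
  stable : ∀ ⦃i j : I⦄ (α : i ⟶ j), carrier i ≤ (carrier j).comap (X α)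

/-- A subrepresentation as a representation in its own right. -/
def Subrep.toRep {X : QRep k V} (A : Subrep X) : QRep k (fun i => A.carrier i) :=
  fun _ _ α => (X α).restrict (A.stable α)

/-- The representation induced by `X` on the subquotient `B / A` (used for `A ⊆ B`). -/
def subquotient {X : QRep k V} (B A : Subrep X) :
    QRep k (fun i => B.carrier i ⧸ (A.carrier i).submoduleOf (B.carrier i)) :=
  fun i j α => Submodule.mapQ ((A.carrier i).submoduleOf (B.carrier i))
    ((A.carrier j).submoduleOf (B.carrier j)) (B.toRep α) fun _ hv => A.stable α hv

/-- `X` is indecomposable: it is nonzero and not the direct sum of two nonzero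
subrepresentations. -/
def Indecomposable (X : QRep k V) : Prop :=
  (∃ i, Nontrivial (V i)) ∧
  ∀ A B : Subrep X, (∀ i, IsCompl (A.carrier i) (B.carrier i)) →
    (∀ i, A.carrier i = ⊥) ∨ (∀ i, B.carrier i = ⊥)

/-- `J_1, …, J_ν` represent the isomorphism classes of finite dimensional indecomposable
representations, each exactly once. -/
def IsListOfIndecomposables {ν : ℕ} {e : Fin ν → I → ℕ} (J : ∀ s, RepVar k (e s)) : Prop :=
  (∀ s, (J s).Indecomposable) ∧
  (∀ s t, (J s).IsIso (J t) → s = t) ∧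
  ∀ (d : I → ℕ) (X : RepVar k d), X.Indecomposable → ∃ s, X.IsIso (J s)

/-! ### Filtrations with prescribed subquotients -/

/-- Filtrations `0 = M^ν ⊆ … ⊆ M^1 ⊆ M^0 = M` of the representation `M` by subrepresentations with
`M^{s-1} / M^s ≅ N_s` for `s = 1, …, ν` (the index `s : Fin ν` below stands for `s + 1`). -/
def filtrations (M : QRep k V) {ν : ℕ} {W : Fin ν → I → Type w₁}
    [∀ s i, AddCommGroup (W s i)] [∀ s i, Module k (W s i)] (N : ∀ s, QRep k (W s)) :
    Set (Fin (ν + 1) → Subrep M) :=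
  {F | (∀ i, (F 0).carrier i = ⊤) ∧ (∀ i, (F (Fin.last ν)).carrier i = ⊥) ∧
    (∀ (s : Fin ν) i, (F s.succ).carrier i ≤ (F s.castSucc).carrier i) ∧
    ∀ s : Fin ν, (subquotient (F s.castSucc) (F s.succ)).IsIso (N s)}

/-! ### The slice attached to a graded decomposition `V = V^1 ⊕ … ⊕ V^ν` -/

section Slice

variable {ν : ℕ} (D : Fin ν → ∀ i, Submodule k (V i))

/-- The flag `F_0^m = ⊕_{t > m} V^t`, `m = 0, …, ν`, of graded subspaces (the index `t : Fin ν`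
stands for `t + 1`, and `F_0^m = 0` for `m ≥ ν`). -/
def flag (m : ℕ) (i : I) : Submodule k (V i) := ⨆ t : {t : Fin ν // m ≤ t.val}, D t.val i

/-- The block of those `X` whose only nonzero components are the maps `(V^s)_i → (V^t)_j` for
arrows `i → j`. -/
def block (s t : Fin ν) : Submodule k (QRep k V) where
  carrier := {X | ∀ ⦃i j : I⦄ (α : i ⟶ j),
    (∀ y ∈ D s i, X α y ∈ D t j) ∧ ∀ r, r ≠ s → ∀ y ∈ D r i, X α y = 0}
  add_mem' := fun {X Y} hX hY _ j α =>
    ⟨fun y hy => (D t j).add_mem ((hX α).1 y hy) ((hY α).1 y hy), fun r hr y hy => by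
      change X α y + Y α y = 0
      rw [(hX α).2 r hr y hy, (hY α).2 r hr y hy, add_zero]⟩
  zero_mem' := fun _ j _ => ⟨fun _ _ => (D t j).zero_mem, fun _ _ _ _ => rfl⟩
  smul_mem' := fun c X hX _ j α =>
    ⟨fun y hy => (D t j).smul_mem c ((hX α).1 y hy), fun r hr y hy => by
      change c • X α y = 0
      rw [(hX α).2 r hr y hy, smul_zero]⟩

/-- The Lie algebra `𝔲` of the unipotent radical of the stabilizer of the flag in `∏_i GL(V_i)`:
all `ξ ∈ ⊕_i 𝔤𝔩(V_i)` with `ξ(F_0^m) ⊆ F_0^{m+1}` for all `m`. -/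
def nilradical : Submodule k (∀ i, V i →ₗ[k] V i) where
  carrier := {ξ | ∀ (m : ℕ) (i : I), ∀ y ∈ flag D m i, ξ i y ∈ flag D (m + 1) i}
  add_mem' := fun hξ hη m i y hy => (flag D (m + 1) i).add_mem (hξ m i y hy) (hη m i y hy)
  zero_mem' := fun m i _ _ => (flag D (m + 1) i).zero_mem
  smul_mem' := fun c _ hξ m i y hy => (flag D (m + 1) i).smul_mem c (hξ m i y hy)

/-- The linear map `φ : ⊕_i 𝔤𝔩(V_i) → ⊕_α Hom(V_i, V_j)`, `φ(ξ)_α = ξ_j N_α - N_α ξ_i`. -/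
def phi (N : QRep k V) : (∀ i, V i →ₗ[k] V i) →ₗ[k] QRep k V where
  toFun ξ := fun i j α => ξ j ∘ₗ N α - N α ∘ₗ ξ i
  map_add' ξ η := by
    funext i j α
    change (ξ j + η j) ∘ₗ N α - N α ∘ₗ (ξ i + η i) =
      (ξ j ∘ₗ N α - N α ∘ₗ ξ i) + (η j ∘ₗ N α - N α ∘ₗ η i)
    rw [LinearMap.add_comp, LinearMap.comp_add]
    abel
  map_smul' c ξ := by
    funext i j α
    change (c • ξ j) ∘ₗ N α - N α ∘ₗ (c • ξ i) = c • (ξ j ∘ₗ N α - N α ∘ₗ ξ i)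
    rw [LinearMap.smul_comp, LinearMap.comp_smul, smul_sub]

/-- `Y_N`: all `X` that are compatible with the flag `F_0` and induce on each
`F_0^{s-1} / F_0^s = V^s` the representation that `N` induces there (the index `s : Fin ν` stands
for `s + 1`). -/
def fiberY (N : QRep k V) : Set (QRep k V) :=
  {X | (∀ (m : ℕ) ⦃i j : I⦄ (α : i ⟶ j), ∀ y ∈ flag D m i, X α y ∈ flag D m j) ∧
    ∀ (s : Fin ν) ⦃i j : I⦄ (α : i ⟶ j), ∀ y ∈ D s i, X α y - N α y ∈ flag D (s.val + 1) j}

/-- `E` is a complement of `φ(𝔲)` in the affine space `Y_N`, identified with its tangent space at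
`N` by `x ↦ N + x`, and `E` is the direct sum of its intersections with the blocks. -/
def IsGradedComplement (N : QRep k V) (E : Submodule k (QRep k V)) : Prop :=
  Disjoint E ((nilradical D).map (phi N)) ∧
  (∀ x : QRep k V, x ∈ E ⊔ (nilradical D).map (phi N) ↔ N + x ∈ fiberY D N) ∧
  E = ⨆ (s : Fin ν) (t : Fin ν), E ⊓ block D s t

/-- The slice `E_N = N + E`. -/
def slice (N : QRep k V) (E : Submodule k (QRep k V)) : Set (QRep k V) := {X | X - N ∈ E}

end Slice

end QRep

/-! Both sides count the set of `g ∈ ∏ GL(V_i)` with `g • M ∈ Y_N`; it has two descriptions.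

Sorting by the point `g • M`, the set is a union of cosets of `Aut(M)`, one for each point of `Y_N ∩
O_M` (`card_smul_mem`). With `U` the unipotent radical, the action map `U × E_N → Y_N` is bijective,
and `O_M` is `U`-stable, so `|Y_N ∩ O_M| = |U| · |E_N ∩ O_M|` (`ncard_fiberY_inter_orbit`).
Injectivity is the heart of the matter (`eq_one_of_smul_mem_slice`): writing `g = 1 + ξ`, the blocks
of `ξ` are killed one diagonal after another, using `E ∩ φ(𝔲) = 0` and `Hom(N_s, N_t) = 0` for `s <
t`. Surjectivity then follows from `|Y_N| ≤ |E| · |𝔲| = |E_N| · |U|`.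

Sorting instead by the filtration that `g` pulls back from the flag, every filtration with
subquotients `N_s` occurs (`exists_filtration`, `exists_adapted`), and the elements over a fixed one
form a single coset of `U · ∏ Aut(N_s)` (`exists_mul_levi`, `mul_levi_injective`). Comparing the
counts and cancelling `|U|` gives the formula. -/

/-! ### Projections of an internal direct sum -/

section InternalProj

variable {k : Type*} [Field k] {W : Type*} [AddCommGroup W] [Module k W]
variable {ν : ℕ} {A : Fin ν → Submodule k W}

/-- The projection of an internal direct sum onto its `s`-th summand. -/
noncomputable def internalProj (h : DirectSum.IsInternal A) (s : Fin ν) : W →ₗ[k] W :=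
  (A s).subtype ∘ₗ DirectSum.component k (Fin ν) (fun t => A t) s ∘ₗ
    (LinearEquiv.ofBijective (DirectSum.coeLinearMap A) h).symm.toLinearMap

theorem internalProj_mem (h : DirectSum.IsInternal A) (s : Fin ν) (y : W) :
    internalProj h s y ∈ A s :=
  Submodule.coe_mem _

theorem internalProj_eq (h : DirectSum.IsInternal A) (s t : Fin ν) {y : W} (hy : y ∈ A t) :
    internalProj h s y = if t = s then y else 0 := by
  have : (LinearEquiv.ofBijective (DirectSum.coeLinearMap A) h).symm y =
      DirectSum.lof k (Fin ν) (fun t => A t) t ⟨y, hy⟩ := by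
    rw [LinearEquiv.symm_apply_eq]
    exact (DirectSum.coeLinearMap_lof A t ⟨y, hy⟩).symm
  simp only [internalProj, LinearMap.comp_apply, LinearEquiv.coe_coe, this]
  split_ifs with hts
  · subst hts
    simp [DirectSum.component.lof_self]
  · simp [DirectSum.component.of, hts]

theorem internalProj_self (h : DirectSum.IsInternal A) {s : Fin ν} {y : W} (hy : y ∈ A s) :
    internalProj h s y = y := by
  rw [internalProj_eq h s s hy, if_pos rfl]

theorem internalProj_of_ne (h : DirectSum.IsInternal A) {s t : Fin ν} (hst : t ≠ s) {y : W}
    (hy : y ∈ A t) : internalProj h s y = 0 := by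
  rw [internalProj_eq h s t hy, if_neg hst]

theorem sum_internalProj (h : DirectSum.IsInternal A) (y : W) :
    ∑ s, internalProj h s y = y := by
  have hy : y ∈ ⨆ t, A t := by rw [h.submodule_iSup_eq_top]; trivial
  induction hy using Submodule.iSup_induction' with
  | mem t y hy => simp [internalProj_eq h _ t hy]
  | zero => simp
  | add y z _ _ hy hz => simp only [map_add, Finset.sum_add_distrib, hy, hz]

/-- Linear maps that agree on all summands of an internal direct sum are equal. -/
theorem linearMap_ext_of_isInternal (h : DirectSum.IsInternal A) {W' : Type*} [AddCommGroup W']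
    [Module k W'] {f g : W →ₗ[k] W'} (hfg : ∀ s, ∀ y ∈ A s, f y = g y) : f = g := by
  ext y
  rw [← sum_internalProj h y, map_sum, map_sum]
  exact Finset.sum_congr rfl fun s _ => hfg s _ (internalProj_mem h s y)

end InternalProj

namespace QRep

variable {I : Type u} {k : Type w} [Field k]
variable {V : I → Type x} [∀ i, AddCommGroup (V i)] [∀ i, Module k (V i)]
variable {ν : ℕ} {D : Fin ν → ∀ i, Submodule k (V i)}

/-! ### The flag of a graded decomposition -/

theorem mem_flag_iff (hD : ∀ i, DirectSum.IsInternal fun s => D s i) {m : ℕ} {i : I} {y : V i} :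
    y ∈ flag D m i ↔ ∀ q : Fin ν, q.val < m → internalProj (hD i) q y = 0 := by
  constructor
  · intro hy q hq
    have : flag D m i ≤ LinearMap.ker (internalProj (hD i) q) := by
      refine iSup_le fun t z hz => ?_
      have : t.1 ≠ q := by
        rintro rfl
        exact absurd t.2 (by omega)
      exact internalProj_of_ne (hD i) this hz
    exact this hy
  · intro hy
    rw [← sum_internalProj (hD i) y]
    refine Submodule.sum_mem _ fun q _ => ?_
    by_cases hq : q.val < m
    · rw [hy q hq]
      exact Submodule.zero_mem _
    · exact Submodule.mem_iSup_of_mem (p := fun t : {t : Fin ν // m ≤ t.val} => D t.val i)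
        ⟨q, by omega⟩ (internalProj_mem (hD i) q y)

theorem le_flag (s : Fin ν) {m : ℕ} (h : m ≤ s.val) (i : I) : D s i ≤ flag D m i :=
  le_iSup (fun t : {t : Fin ν // m ≤ t.val} => D t.val i) ⟨s, h⟩

theorem flag_anti (i : I) {m n : ℕ} (h : m ≤ n) : flag D n i ≤ flag D m i :=
  iSup_le fun t => le_flag t.1 (h.trans t.2) i

theorem flag_eq_bot (i : I) {m : ℕ} (h : ν ≤ m) : flag D m i = ⊥ := by
  refine le_bot_iff.1 (iSup_le fun t => ?_)
  exact absurd t.2 (by have := t.1.2; omega)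

theorem mem_flag_zero (hD : ∀ i, DirectSum.IsInternal fun s => D s i) (i : I) (y : V i) :
    y ∈ flag D 0 i :=
  (mem_flag_iff hD).2 fun _ h => absurd h (Nat.not_lt_zero _)

/-- To lie in a step of the flag may be checked by descending along the flag. -/
theorem mem_flag_of_forall_lt (hD : ∀ i, DirectSum.IsInternal fun s => D s i) {m : ℕ} {i : I}
    {y : V i} (h : ∀ j < m, y ∈ flag D j i → y ∈ flag D (j + 1) i) : y ∈ flag D m i := by
  have : ∀ j ≤ m, y ∈ flag D j i := by
    intro j
    induction j with
    | zero => exact fun _ => mem_flag_zero hD i y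
    | succ j ih => exact fun hj => h j hj (ih (by omega))
  exact this m le_rfl

theorem sub_internalProj_mem_flag (hD : ∀ i, DirectSum.IsInternal fun s => D s i) (s : Fin ν)
    {i : I} {y : V i} (hy : y ∈ flag D s.val i) :
    y - internalProj (hD i) s y ∈ flag D (s.val + 1) i := by
  rw [mem_flag_iff hD] at hy ⊢
  intro q hq
  rw [map_sub, internalProj_eq (hD i) q s (internalProj_mem (hD i) s y)]
  split_ifs with h
  · rw [h, sub_self]
  · rw [hy q (by have := Fin.val_ne_of_ne h; omega), sub_zero]

/-- The `s`-th projection realizes the isomorphism of the flag's subquotient with `V^s`; all later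
computations in subquotients go through this kernel description. -/
theorem mem_flag_succ_iff (hD : ∀ i, DirectSum.IsInternal fun s => D s i) (s : Fin ν)
    {i : I} {y : V i} : y ∈ flag D (s.val + 1) i ↔
      y ∈ flag D s.val i ∧ internalProj (hD i) s y = 0 := by
  refine ⟨fun h => ⟨flag_anti i (Nat.le_succ _) h, (mem_flag_iff hD).1 h s (Nat.lt_succ_self _)⟩,
    fun ⟨h, h0⟩ => ?_⟩
  simpa [h0] using sub_internalProj_mem_flag hD s h

/-- A map that sends each summand into a step of the flag preserves inclusions into steps. -/
theorem map_mem_of_forall_summand {i : I} {W : Type*} [AddCommGroup W] [Module k W]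
    (f : V i →ₗ[k] W) {m : ℕ} {B : Submodule k W}
    (h : ∀ s : Fin ν, m ≤ s.val → ∀ y ∈ D s i, f y ∈ B) {y : V i} (hy : y ∈ flag D m i) :
    f y ∈ B := by
  have : flag D m i ≤ B.comap f := iSup_le fun t z hz => h t.1 t.2 z hz
  exact this hy

/-! ### The unipotent radical -/

variable (D) in
/-- The unipotent radical of the stabilizer of the flag. -/
def unipotentRadical (hD : ∀ i, DirectSum.IsInternal fun s => D s i) :
    Subgroup (∀ i, V i ≃ₗ[k] V i) where
  carrier := {g | ∀ (m : ℕ) (i : I), ∀ y ∈ flag D m i, g i y - y ∈ flag D (m + 1) i}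
  one_mem' := fun m i y _ => by simp
  mul_mem' := fun {g h} hg hh m i y hy => by
    have h1 := hh m i y hy
    have h2 : h i y ∈ flag D m i := by
      simpa using Submodule.add_mem _ (flag_anti i (Nat.le_succ m) h1) hy
    simpa using Submodule.add_mem _ (hg m i _ h2) h1
  inv_mem' := fun {g} hg m i y hy => by
    -- Descent: if `z = g⁻¹ y` lies in step `j < m`, then `g z - z = y - z` lies in step `j + 1`,
    -- and so does `y`; hence so does `z`.
    have key : ((g⁻¹) i y) ∈ flag D m i := by
      refine mem_flag_of_forall_lt hD fun j hj h => ?_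
      have h1 := hg j i _ h
      have h2 : g i (g⁻¹ i y) = y := (g i).apply_symm_apply y
      rw [h2] at h1
      simpa using Submodule.sub_mem _ (flag_anti i (by omega : j + 1 ≤ m) hy) h1
    have h1 := hg m i _ key
    have h2 : g i (g⁻¹ i y) = y := (g i).apply_symm_apply y
    rw [h2] at h1
    simpa using Submodule.neg_mem _ h1

theorem mem_flag_iff_of_mem_unipotentRadical (hD : ∀ i, DirectSum.IsInternal fun s => D s i)
    {g : ∀ i, V i ≃ₗ[k] V i} (hg : g ∈ unipotentRadical D hD) (m : ℕ) (i : I) (y : V i) :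
    g i y ∈ flag D m i ↔ y ∈ flag D m i := by
  have key : ∀ g : ∀ i, V i ≃ₗ[k] V i, g ∈ unipotentRadical D hD → ∀ y ∈ flag D m i, g i y ∈ flag D m i := by
    intro g hg y hy
    simpa using Submodule.add_mem _ (flag_anti i (Nat.le_succ m) (hg m i y hy)) hy
  refine ⟨fun h => ?_, key g hg y⟩
  have := key _ (inv_mem hg) _ h
  rwa [show (g⁻¹) i (g i y) = y from (g i).symm_apply_apply y] at this

/-- The unipotent radical is `1 + 𝔲`. -/
theorem card_unipotentRadical (hD : ∀ i, DirectSum.IsInternal fun s => D s i)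
    [∀ i, FiniteDimensional k (V i)] :
    Nat.card (unipotentRadical D hD) = Nat.card (nilradical D) := by
  refine Nat.card_congr (Equiv.ofBijective
    (fun g : unipotentRadical D hD =>
      (⟨fun i => (g.1 i : V i →ₗ[k] V i) - LinearMap.id, fun m i y hy => g.2 m i y hy⟩ :
        nilradical D)) ⟨fun g h hgh => ?_, fun ξ => ?_⟩)
  · ext i y
    have := congrFun (congrArg (fun ξ : nilradical D => ξ.1) hgh) i
    simpa using LinearMap.congr_fun this y
  -- A kernel vector satisfies `y = -ξ y`, so it descends the whole flag and ends in step `ν`, which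
  -- is zero.
  · have hinj (i : I) : Function.Injective (ξ.1 i + (LinearMap.id : V i →ₗ[k] V i)) := by
      rw [← LinearMap.ker_eq_bot, LinearMap.ker_eq_bot']
      intro y hy
      have : y ∈ flag D ν i := by
        refine mem_flag_of_forall_lt hD fun j _ h => ?_
        have h1 := ξ.2 j i y h
        have h2 : y = - ξ.1 i y := (neg_eq_of_add_eq_zero_right hy).symm
        rw [h2]
        exact Submodule.neg_mem _ h1
      simpa [flag_eq_bot i le_rfl] using this
    refine ⟨⟨fun i => LinearEquiv.ofInjectiveEndo (ξ.1 i + LinearMap.id) (hinj i),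
      fun m i y hy => ?_⟩, ?_⟩
    · simpa using ξ.2 m i y hy
    · ext i y
      simp

/-! ### Descriptions by blocks -/

/-- In block form, `𝔲` is the strictly triangular part: only blocks from `V^s` to `V^t` with `s < t`
survive. -/
theorem mem_nilradical_iff (hD : ∀ i, DirectSum.IsInternal fun s => D s i)
    {ξ : ∀ i, V i →ₗ[k] V i} : ξ ∈ nilradical D ↔
      ∀ (i : I) (s t : Fin ν), t ≤ s → ∀ y ∈ D s i, internalProj (hD i) t (ξ i y) = 0 := by
  constructor
  · intro h i s t hts y hy
    exact (mem_flag_iff hD).1 (h s.val i y (le_flag s le_rfl i hy)) t (Nat.lt_succ_of_le hts)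
  · intro h m i y hy
    refine map_mem_of_forall_summand (ξ i) (fun s hs z hz => (mem_flag_iff hD).2 fun q hq => ?_) hy
    exact h i s q (Fin.le_def.2 (by omega)) z hz

variable [Quiver.{v} I]

theorem smul_apply (g : ∀ i, V i ≃ₗ[k] V i) (M : QRep k V) {i j : I} (α : i ⟶ j) (y : V i) :
    (g • M) α y = g j (M α ((g i).symm y)) := rfl

/-- As `N` is block diagonal, the tangent directions of `Y_N` are again the strictly triangular
ones. -/
theorem mem_fiberY_iff (hD : ∀ i, DirectSum.IsInternal fun s => D s i) {N x : QRep k V}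
    (hN : ∀ s ⦃i j : I⦄ (α : i ⟶ j), ∀ y ∈ D s i, N α y ∈ D s j) :
    N + x ∈ fiberY D N ↔ ∀ ⦃i j : I⦄ (α : i ⟶ j) (s t : Fin ν), t ≤ s → ∀ y ∈ D s i,
      internalProj (hD j) t (x α y) = 0 := by
  have hadd : ∀ ⦃i j : I⦄ (α : i ⟶ j) (y : V i), (N + x) α y = N α y + x α y :=
    fun _ _ _ _ => rfl
  constructor
  · rintro ⟨-, h⟩ i j α s t hts y hy
    have := h s α y hy
    rw [hadd, add_sub_cancel_left] at this
    exact (mem_flag_iff hD).1 this t (Nat.lt_succ_of_le hts)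
  · intro h
    have key : ∀ (s : Fin ν) ⦃i j : I⦄ (α : i ⟶ j), ∀ y ∈ D s i,
        (N + x) α y - N α y ∈ flag D (s.val + 1) j := by
      intro s i j α y hy
      rw [hadd, add_sub_cancel_left]
      exact (mem_flag_iff hD).2 fun q hq => h α s q (Fin.le_def.2 (by omega)) y hy
    refine ⟨fun m i j α y hy => ?_, key⟩
    refine map_mem_of_forall_summand _ (fun s hs z hz => ?_) hy
    have h1 := flag_anti j (by omega : m ≤ s.val + 1) (key s α z hz)
    simpa using Submodule.add_mem _ h1 (le_flag s hs j (hN s α z hz))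

theorem internalProj_comm (hD : ∀ i, DirectSum.IsInternal fun s => D s i) {N : QRep k V}
    (hN : ∀ s ⦃i j : I⦄ (α : i ⟶ j), ∀ y ∈ D s i, N α y ∈ D s j) (s : Fin ν) ⦃i j : I⦄
    (α : i ⟶ j) (y : V i) :
    internalProj (hD j) s (N α y) = N α (internalProj (hD i) s y) := by
  have : internalProj (hD j) s ∘ₗ N α = N α ∘ₗ internalProj (hD i) s := by
    refine linearMap_ext_of_isInternal (hD i) fun t y hy => ?_
    simp only [LinearMap.comp_apply, internalProj_eq (hD i) s t hy,
      internalProj_eq (hD j) s t (hN t α y hy)]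
    split_ifs <;> simp
  exact LinearMap.congr_fun this y

end QRep

namespace QRep

variable {I : Type u} {k : Type w} [Field k]
variable {V : I → Type x} [∀ i, AddCommGroup (V i)] [∀ i, Module k (V i)]
variable {ν : ℕ} {D : Fin ν → ∀ i, Submodule k (V i)}

/-! ### Block components -/

/-- The component of a graded endomorphism that maps `V^s` to `V^t`. -/
noncomputable def endBlock (hD : ∀ i, DirectSum.IsInternal fun s => D s i) (s t : Fin ν)
    (ξ : ∀ i, V i →ₗ[k] V i) : ∀ i, V i →ₗ[k] V i :=
  fun i => internalProj (hD i) t ∘ₗ ξ i ∘ₗ internalProj (hD i) s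

theorem endBlock_mem_nilradical (hD : ∀ i, DirectSum.IsInternal fun s => D s i) (s t : Fin ν)
    {ξ : ∀ i, V i →ₗ[k] V i} (hξ : ξ ∈ nilradical D) : endBlock hD s t ξ ∈ nilradical D := by
  rw [mem_nilradical_iff hD] at hξ ⊢
  intro i s' t' h y hy
  simp only [endBlock, LinearMap.comp_apply, internalProj_eq (hD i) s s' hy]
  split_ifs with h1
  · subst h1
    rw [internalProj_eq (hD i) t' t (internalProj_mem (hD i) _ _)]
    split_ifs with h2
    · subst h2
      exact hξ i s' t h y hy
    · rfl
  · simp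

variable [Quiver.{v} I]

/-- The component in the block `(s, t)`, as a linear map. -/
noncomputable def blockProj (hD : ∀ i, DirectSum.IsInternal fun s => D s i) (s t : Fin ν) :
    QRep k V →ₗ[k] QRep k V where
  toFun X := fun i j α => internalProj (hD j) t ∘ₗ X α ∘ₗ internalProj (hD i) s
  map_add' X Y := by
    funext i j α
    ext y
    exact map_add (internalProj (hD j) t) _ _
  map_smul' c X := by
    funext i j α
    ext y
    exact map_smul (internalProj (hD j) t) c _

theorem blockProj_apply (hD : ∀ i, DirectSum.IsInternal fun s => D s i) (s t : Fin ν)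
    (X : QRep k V) {i j : I} (α : i ⟶ j) (y : V i) :
    blockProj hD s t X α y = internalProj (hD j) t (X α (internalProj (hD i) s y)) := rfl

theorem ext_apply {X Y : QRep k V} (h : ∀ ⦃i j : I⦄ (α : i ⟶ j) (y : V i), X α y = Y α y) :
    X = Y := by
  funext i j α
  exact LinearMap.ext (h α)

theorem blockProj_of_mem_block (hD : ∀ i, DirectSum.IsInternal fun s => D s i) (s t : Fin ν)
    {s' t' : Fin ν} {X : QRep k V} (hX : X ∈ block D s' t') :
    blockProj hD s t X = if s' = s ∧ t' = t then X else 0 := by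
  split_ifs with h
  · obtain ⟨rfl, rfl⟩ := h
    refine ext_apply fun i j α y => ?_
    have h0 : X α y = X α (internalProj (hD i) s' y) := by
      conv_lhs => rw [← sum_internalProj (hD i) y, map_sum]
      exact Finset.sum_eq_single _ (fun r _ hr => (hX α).2 r hr _ (internalProj_mem (hD i) r y))
        (by simp)
    rw [blockProj_apply, h0, internalProj_self (hD j) ((hX α).1 _ (internalProj_mem (hD i) _ y))]
  · refine ext_apply fun i j α y => ?_
    rw [blockProj_apply]
    change _ = (0 : V j)
    by_cases hs : s' = s
    · subst hs
      exact internalProj_of_ne (hD j) (fun ht => h ⟨rfl, ht⟩)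
        ((hX α).1 _ (internalProj_mem (hD i) _ y))
    · rw [(hX α).2 s (Ne.symm hs) _ (internalProj_mem (hD i) s y), map_zero]

/-- This is what the grading of `E` by blocks provides: equations in `E` may be studied one block at
a time. -/
theorem blockProj_mem (hD : ∀ i, DirectSum.IsInternal fun s => D s i) (s t : Fin ν)
    {E : Submodule k (QRep k V)} (hE : E = ⨆ (s : Fin ν) (t : Fin ν), E ⊓ block D s t)
    {X : QRep k V} (hX : X ∈ E) : blockProj hD s t X ∈ E := by
  have : E ≤ E.comap (blockProj hD s t) := by
    conv_lhs => rw [hE]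
    refine iSup_le fun s' => iSup_le fun t' Y hY => ?_
    rw [Submodule.mem_comap, blockProj_of_mem_block hD s t hY.2]
    split_ifs
    · exact hY.1
    · exact E.zero_mem
  exact this hX

theorem phi_apply (N : QRep k V) (ξ : ∀ i, V i →ₗ[k] V i) {i j : I} (α : i ⟶ j) (y : V i) :
    phi N ξ α y = ξ j (N α y) - N α (ξ i y) := rfl

theorem blockProj_phi (hD : ∀ i, DirectSum.IsInternal fun s => D s i) {N : QRep k V}
    (hN : ∀ s ⦃i j : I⦄ (α : i ⟶ j), ∀ y ∈ D s i, N α y ∈ D s j) (s t : Fin ν)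
    (ξ : ∀ i, V i →ₗ[k] V i) : blockProj hD s t (phi N ξ) = phi N (endBlock hD s t ξ) := by
  refine ext_apply fun i j α y => ?_
  simp only [blockProj_apply, phi_apply, endBlock, LinearMap.comp_apply, map_sub,
    internalProj_comm hD hN]

/-! ### The action of the unipotent radical on the slice -/

/-- A block of `ξ` commuting with `N` is a morphism `N_s → N_t`, so directedness kills it. -/
theorem endBlock_eq_zero (hD : ∀ i, DirectSum.IsInternal fun s => D s i) {N : QRep k V}
    {Ns : Fin ν → N.Subrep} (hNs : ∀ s, (Ns s).carrier = D s) {s t : Fin ν}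
    (hst : (Ns s).toRep.HomZero (Ns t).toRep) {ξ : ∀ i, V i →ₗ[k] V i}
    (h : phi N (endBlock hD s t ξ) = 0) : endBlock hD s t ξ = 0 := by
  obtain rfl : (fun s => (Ns s).carrier) = D := funext hNs
  have hz := hst (fun i => LinearMap.codRestrict ((Ns t).carrier i)
    (internalProj (hD i) t ∘ₗ ξ i ∘ₗ ((Ns s).carrier i).subtype)
    fun y => internalProj_mem (hD i) t _) (fun i j α => by
      ext y
      have h1 := LinearMap.congr_fun (congrFun (congrFun (congrFun h i) j) α) y.1
      have h2 : phi N (endBlock hD s t ξ) α y.1 = 0 := h1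
      rw [phi_apply, sub_eq_zero] at h2
      simp only [endBlock, LinearMap.comp_apply, internalProj_self (hD i) y.2,
        internalProj_self (hD j) ((Ns s).stable α y.2)] at h2
      exact h2)
  funext i
  ext y
  exact congrArg Subtype.val (LinearMap.congr_fun (hz i)
    ⟨internalProj (hD i) s y, internalProj_mem (hD i) s y⟩)

/-- An element of the unipotent radical that maps a point of the slice to a point of the slice
is trivial. -/
theorem eq_one_of_smul_mem_slice (hD : ∀ i, DirectSum.IsInternal fun s => D s i) {N : QRep k V}
    {Ns : Fin ν → N.Subrep} (hNs : ∀ s, (Ns s).carrier = D s)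
    (hhom : ∀ s t, s < t → (Ns s).toRep.HomZero (Ns t).toRep)
    {E : Submodule k (QRep k V)} (hE : IsGradedComplement D N E)
    {g : ∀ i, V i ≃ₗ[k] V i} (hg : g ∈ unipotentRadical D hD) {X : QRep k V}
    (hX : X ∈ slice N E) (hgX : g • X ∈ slice N E) : g = 1 := by
  have hN : ∀ s ⦃i j : I⦄ (α : i ⟶ j), ∀ y ∈ D s i, N α y ∈ D s j := by
    intro s i j α y hy
    rw [← hNs] at hy ⊢
    exact (Ns s).stable α hy
  obtain ⟨hdisj, hspan, hgr⟩ := hE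
  have hup : ∀ x ∈ E, ∀ ⦃i j : I⦄ (α : i ⟶ j) (s t : Fin ν), t ≤ s → ∀ y ∈ D s i,
      internalProj (hD j) t (x α y) = 0 := fun x hx =>
    (mem_fiberY_iff hD hN).1 ((hspan x).1 (Submodule.mem_sup_left hx))
  set x := X - N with hx
  set x' := g • X - N with hx'
  have hxE : x ∈ E := hX
  have hxE' : x' ∈ E := hgX
  set ξ : ∀ i, V i →ₗ[k] V i := fun i => (g i : V i →ₗ[k] V i) - LinearMap.id with hξdef
  have hξ : ξ ∈ nilradical D := fun m i y hy => hg m i y hy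
  have hξ' := (mem_nilradical_iff hD).1 hξ
  -- Expand `(g • M) ∘ g = g ∘ M`, for `X` in place of `M`, with `g = 1 + ξ`, `X = N + x`, `g • X =
  -- N + x'`: the linear terms are collected on the left, the products with `ξ` on the right.
  have heq : ∀ ⦃i j : I⦄ (α : i ⟶ j) (y : V i),
      (x - x' + phi N ξ) α y = x' α (ξ i y) - ξ j (x α y) := by
    intro i j α y
    have hXa : ∀ y, X α y = N α y + x α y := fun y => (add_sub_cancel (N α y) (X α y)).symm
    have hXa' : ∀ y, (g • X) α y = N α y + x' α y :=
      fun y => (add_sub_cancel (N α y) ((g • X) α y)).symm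
    have h1 : (g • X) α (g i y) = g j (X α y) := by
      rw [smul_apply, LinearEquiv.symm_apply_apply]
    have hgy : ∀ i (y : V i), g i y = y + ξ i y := fun i y => (add_sub_cancel y (g i y)).symm
    rw [hXa', hXa, hgy, hgy] at h1
    simp only [map_add] at h1
    change x α y - x' α y + (ξ j (N α y) - N α (ξ i y)) = _
    rw [← sub_eq_zero] at h1 ⊢
    rw [← neg_eq_zero, ← h1]
    abel
  -- Induction on the distance from the diagonal. The subtraction is truncated, so the case `n = 0`
  -- covers all `t ≤ s`, where `ξ ∈ 𝔲` suffices.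
  have key : ∀ n : ℕ, ∀ s t : Fin ν, t.val - s.val ≤ n →
      endBlock hD s t ξ = 0 := by
    intro n
    induction n with
    | zero =>
      intro s t hst
      funext i
      ext y
      exact hξ' i s t (Fin.le_def.2 (by omega)) _ (internalProj_mem (hD i) s y)
    | succ n ih =>
      intro s t hst
      rcases Nat.lt_or_ge n (t.val - s.val) with hn | hn
      swap
      · exact ih s t hn
      have h0 : ∀ {q r : Fin ν}, r.val - q.val ≤ n → ∀ {i : I} {y : V i}, y ∈ D q i →
          internalProj (hD i) r (ξ i y) = 0 := by
        intro q r hqr i y hy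
        have h1 : endBlock hD q r ξ i y = 0 := by rw [ih q r hqr]; rfl
        simpa only [endBlock, LinearMap.comp_apply, internalProj_self (hD i) hy] using h1
      -- Since `x` and `x'` strictly raise the index, block `(s, t)` of `x' ξ - ξ x` involves only
      -- blocks of `ξ` closer to the diagonal, which vanish by induction.
      have hsum : blockProj hD s t (x - x') + phi N (endBlock hD s t ξ) = 0 := by
        rw [← blockProj_phi hD hN, ← map_add]
        refine ext_apply fun i j α y => ?_
        rw [blockProj_apply, heq, map_sub]
        have hy := internalProj_mem (hD i) s y
        set z := internalProj (hD i) s y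
        have h1 : internalProj (hD j) t (x' α (ξ i z)) = 0 := by
          rw [← sum_internalProj (hD i) (ξ i z), map_sum, map_sum]
          refine Finset.sum_eq_zero fun q _ => ?_
          rcases lt_or_ge q t with hq | hq
          · rw [Fin.lt_def] at hq
            rw [h0 (by omega) hy, map_zero, map_zero]
          · exact hup x' hxE' α q t hq _ (internalProj_mem (hD i) q _)
        have h2 : internalProj (hD j) t (ξ j (x α z)) = 0 := by
          rw [← sum_internalProj (hD j) (x α z), map_sum, map_sum]
          refine Finset.sum_eq_zero fun q _ => ?_
          rcases lt_or_ge s q with hq | hq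
          · rw [Fin.lt_def] at hq
            exact h0 (by omega) (internalProj_mem (hD j) q _)
          · rw [hup x hxE α s q hq z hy, map_zero, map_zero]
        rw [h1, h2, sub_zero]
        rfl
      -- The block of `φ(ξ)` is thus the negative of a block of `x - x' ∈ E`, and it also lies in
      -- `φ(𝔲)`, so it is zero.
      have hmem : phi N (endBlock hD s t ξ) ∈ E := by
        rw [← neg_eq_of_add_eq_zero_right hsum]
        exact E.neg_mem (blockProj_mem hD s t hgr (E.sub_mem hxE hxE'))
      have hphi := Submodule.disjoint_def.1 hdisj _ hmem
        (Submodule.mem_map_of_mem (endBlock_mem_nilradical hD s t hξ))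
      exact endBlock_eq_zero hD hNs (hhom s t (Fin.lt_def.2 (by omega))) hphi
  funext i
  ext y
  have hzero : ξ i y = 0 := by
    rw [← sum_internalProj (hD i) (ξ i y)]
    refine Finset.sum_eq_zero fun t _ => ?_
    rw [← sum_internalProj (hD i) y, map_sum, map_sum]
    exact Finset.sum_eq_zero fun s _ => LinearMap.congr_fun (congrFun (key _ s t le_rfl) i) y
  exact sub_eq_zero.1 hzero

theorem smul_mem_fiberY (hD : ∀ i, DirectSum.IsInternal fun s => D s i) {N : QRep k V}
    {g : ∀ i, V i ≃ₗ[k] V i} (hg : g ∈ unipotentRadical D hD) {X : QRep k V}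
    (hX : X ∈ fiberY D N) : g • X ∈ fiberY D N := by
  have hinv : ∀ m i, ∀ y ∈ flag D m i,
      (g i).symm y ∈ flag D m i ∧ (g i).symm y - y ∈ flag D (m + 1) i := fun m i y hy =>
    ⟨(mem_flag_iff_of_mem_unipotentRadical hD (inv_mem hg) m i y).2 hy, inv_mem hg m i y hy⟩
  refine ⟨fun m i j α y hy => ?_, fun s i j α y hy => ?_⟩
  · rw [smul_apply, mem_flag_iff_of_mem_unipotentRadical hD hg]
    exact hX.1 m α _ (hinv m i y hy).1
  · obtain ⟨h1, h2⟩ := hinv s.val i y (le_flag s le_rfl i hy)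
    -- The difference `g X g⁻¹ y - N y` splits as `(g - 1) X g⁻¹ y + X (g⁻¹ y - y) + (X y - N y)`;
    -- each term lies in the next step of the flag.
    have h3 := hg s.val j _ (hX.1 s.val α _ h1)
    have h4 := hX.1 (s.val + 1) α _ h2
    rw [map_sub] at h4
    have := Submodule.add_mem _ (Submodule.add_mem _ h3 h4) (hX.2 s α y hy)
    rw [smul_apply]
    simpa using this

/-! ### Finiteness, and counting points of the fibre and of orbits -/

instance [Finite I] [∀ i j : I, Finite (i ⟶ j)] [∀ i, Finite (V i)] : Finite (QRep k V) :=
  have (i j : I) : Finite (V i →ₗ[k] V j) := DFunLike.finite _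
  inferInstanceAs (Finite (∀ i j : I, (i ⟶ j) → (V i →ₗ[k] V j)))

instance finite_linearMap [Finite I] [∀ i, Finite (V i)] : Finite (∀ i, V i →ₗ[k] V i) :=
  have (i : I) : Finite (V i →ₗ[k] V i) := DFunLike.finite _
  inferInstance

instance finite_linearEquiv [Finite I] [∀ i, Finite (V i)] : Finite (∀ i, V i ≃ₗ[k] V i) :=
  have (i : I) : Finite (V i ≃ₗ[k] V i) := DFunLike.finite _
  inferInstance

theorem smul_mem_orbit_iff (g : ∀ i, V i ≃ₗ[k] V i) (X M : QRep k V) :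
    g • X ∈ M.orbit ↔ X ∈ M.orbit := by
  refine ⟨fun h => ?_, MulAction.mem_orbit_of_mem_orbit g⟩
  have := MulAction.mem_orbit_of_mem_orbit g⁻¹ h
  rwa [inv_smul_smul] at this

/-- Every orbit of the unipotent radical on the fibre meets the slice exactly once; counted on
a single orbit of `∏_i GL(V_i)`. -/
theorem ncard_fiberY_inter_orbit [Finite I] [∀ i j : I, Finite (i ⟶ j)] [∀ i, Finite (V i)]
    (hD : ∀ i, DirectSum.IsInternal fun s => D s i) {N : QRep k V}
    {Ns : Fin ν → N.Subrep} (hNs : ∀ s, (Ns s).carrier = D s)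
    (hhom : ∀ s t, s < t → (Ns s).toRep.HomZero (Ns t).toRep)
    {E : Submodule k (QRep k V)} (hE : IsGradedComplement D N E) (M : QRep k V) :
    (fiberY D N ∩ M.orbit).ncard =
      Nat.card (unipotentRadical D hD) * (slice N E ∩ M.orbit).ncard := by
  have hslice : ∀ X ∈ slice N E, X ∈ fiberY D N := by
    intro X hX
    have := (hE.2.1 (X - N)).1 (Submodule.mem_sup_left hX)
    rwa [add_sub_cancel] at this
  let f : unipotentRadical D hD × slice N E → fiberY D N :=
    fun p => ⟨p.1.1 • p.2.1, smul_mem_fiberY hD p.1.2 (hslice _ p.2.2)⟩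
  have hinj : Function.Injective f := by
    rintro ⟨g, X⟩ ⟨h, Y⟩ hfg
    have h1 : g.1 • X.1 = h.1 • Y.1 := congrArg Subtype.val hfg
    have h2 : (h⁻¹ * g).1 • X.1 = Y.1 := by
      rw [Subgroup.coe_mul, mul_smul, h1, Subgroup.coe_inv, inv_smul_smul]
    have h3 : (h⁻¹ * g).1 = 1 := eq_one_of_smul_mem_slice hD hNs hhom hE (h⁻¹ * g).2 X.2
      (by rw [h2]; exact Y.2)
    have h4 : g = h := (inv_mul_eq_one.1 (Subtype.ext h3)).symm
    rw [h3, one_smul] at h2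
    exact Prod.ext h4 (Subtype.ext h2)
  -- Surjectivity by counting: `(e, ξ) ↦ N + e + φ(ξ)` maps `E × 𝔲` onto the fibre, and `|𝔲| = |U|`,
  -- `|E| = |E_N|`.
  have hcard : Nat.card (fiberY D N) ≤ Nat.card (unipotentRadical D hD × slice N E) := by
    have hsl : Nat.card (slice N E) = Nat.card E :=
      Nat.card_congr ((Equiv.subRight N).subtypeEquiv fun X => Iff.rfl)
    rw [Nat.card_prod, card_unipotentRadical, hsl, mul_comm, ← Nat.card_prod]
    refine Nat.card_le_card_of_surjective (fun p : E × nilradical D =>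
      (⟨N + (p.1.1 + phi N p.2.1), (hE.2.1 _).1 (Submodule.add_mem_sup p.1.2
        (Submodule.mem_map_of_mem p.2.2))⟩ : fiberY D N)) fun Y => ?_
    have hY : Y.1 - N ∈ E ⊔ (nilradical D).map (phi N) := by
      rw [hE.2.1, add_sub_cancel]
      exact Y.2
    obtain ⟨e, he, z, ⟨ξ, hξ, rfl⟩, h⟩ := Submodule.mem_sup.1 hY
    refine ⟨⟨⟨e, he⟩, ⟨ξ, hξ⟩⟩, Subtype.ext ?_⟩
    change N + (e + phi N ξ) = Y.1
    rw [h, add_sub_cancel]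
  have hbij := hinj.bijective_of_nat_card_le hcard
  rw [← Nat.card_coe_set_eq, ← Nat.card_coe_set_eq, ← Nat.card_prod]
  symm
  refine Nat.card_congr (Equiv.ofBijective
    (fun p : unipotentRadical D hD × (slice N E ∩ M.orbit : Set _) =>
      (⟨p.1.1 • p.2.1, smul_mem_fiberY hD p.1.2 (hslice _ p.2.2.1),
        (smul_mem_orbit_iff _ _ _).2 p.2.2.2⟩ : (fiberY D N ∩ M.orbit : Set _)))
    ⟨fun p q hpq => ?_, fun Y => ?_⟩)
  · have := @hinj (p.1, ⟨p.2.1, p.2.2.1⟩) (q.1, ⟨q.2.1, q.2.2.1⟩)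
      (Subtype.ext (show p.1.1 • p.2.1 = q.1.1 • q.2.1 from congrArg Subtype.val hpq))
    simp only [Prod.mk.injEq, Subtype.mk.injEq] at this
    exact Prod.ext this.1 (Subtype.ext this.2)
  · obtain ⟨⟨g, X⟩, h⟩ := hbij.2 ⟨Y.1, Y.2.1⟩
    have h' : g.1 • X.1 = Y.1 := congrArg Subtype.val h
    refine ⟨(g, ⟨X.1, X.2, ?_⟩), Subtype.ext h'⟩
    have hY := Y.2.2
    rw [← h'] at hY
    exact (smul_mem_orbit_iff _ _ _).1 hY

/-- Orbit counting: the elements of `∏_i GL(V_i)` that move `M` into a given set. -/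
theorem card_smul_mem (M : QRep k V) (Y : Set (QRep k V)) :
    Nat.card {g : ∀ i, V i ≃ₗ[k] V i // g • M ∈ Y} = Nat.card M.Aut * (Y ∩ M.orbit).ncard := by
  -- `c X` carries `M` to `X`, so the elements carrying `M` to `X` form the coset `c X · Aut(M)`.
  choose c hc using fun X : (Y ∩ M.orbit : Set _) => X.2.2
  replace hc : ∀ X : (Y ∩ M.orbit : Set _), c X • M = X.1 := hc
  have hA : ∀ a : M.Aut, a.1 • M = M := fun a => a.2
  rw [← Nat.card_coe_set_eq, ← Nat.card_prod]
  symm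
  refine Nat.card_congr (Equiv.ofBijective (fun p : M.Aut × (Y ∩ M.orbit : Set _) =>
    (⟨c p.2 * p.1.1, by rw [mul_smul, hA, hc]; exact p.2.2.1⟩ :
      {g : ∀ i, V i ≃ₗ[k] V i // g • M ∈ Y})) ⟨?_, ?_⟩)
  · rintro ⟨a, X⟩ ⟨b, X'⟩ h
    have h1 : c X * a.1 = c X' * b.1 := congrArg Subtype.val h
    have h2 : X = X' := by
      have := congrArg (· • M) h1
      simp only [mul_smul, hA, hc] at this
      exact Subtype.ext this
    subst h2
    exact Prod.ext (Subtype.ext (mul_left_cancel h1)) rfl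
  · rintro ⟨g, hg⟩
    let X : (Y ∩ M.orbit : Set _) := ⟨g • M, hg, MulAction.mem_orbit M g⟩
    refine ⟨(⟨(c X)⁻¹ * g, ?_⟩, X), Subtype.ext (mul_inv_cancel_left _ _)⟩
    change ((c X)⁻¹ * g) • M = M
    rw [mul_smul, inv_smul_eq_iff, hc]

end QRep


/-! ### Gluing linear maps along an internal direct sum -/

section SumMap

variable {k : Type*} [Field k] {W W' : Type*} [AddCommGroup W] [Module k W]
variable [AddCommGroup W'] [Module k W'] {ν : ℕ} {A : Fin ν → Submodule k W}

/-- The linear map on an internal direct sum with given restrictions to the summands. -/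
noncomputable def sumMap (h : DirectSum.IsInternal A) (f : ∀ s, A s →ₗ[k] W') : W →ₗ[k] W' :=
  ∑ s, f s ∘ₗ LinearMap.codRestrict (A s) (internalProj h s) (internalProj_mem h s)

theorem sumMap_apply (h : DirectSum.IsInternal A) (f : ∀ s, A s →ₗ[k] W') {s : Fin ν}
    (y : A s) : sumMap h f y = f s y := by
  rw [sumMap, LinearMap.sum_apply, Finset.sum_eq_single s]
  · rw [LinearMap.comp_apply]
    congr 1
    exact Subtype.ext (internalProj_self h y.2)
  · intro t _ hts
    have : LinearMap.codRestrict (A t) (internalProj h t) (internalProj_mem h t) y = 0 :=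
      Subtype.ext (internalProj_of_ne h hts.symm y.2)
    rw [LinearMap.comp_apply, this, map_zero]
  · simp

/-- The automorphism of an internal direct sum given by automorphisms of the summands. -/
noncomputable def sumEquiv (h : DirectSum.IsInternal A) (f : ∀ s, A s ≃ₗ[k] A s) : W ≃ₗ[k] W :=
  LinearEquiv.ofLinearMap (sumMap h fun s => (A s).subtype ∘ₗ (f s).toLinearMap)
    (sumMap h fun s => (A s).subtype ∘ₗ (f s).symm.toLinearMap)
    (linearMap_ext_of_isInternal h fun s y hy => by
      rw [LinearMap.comp_apply, sumMap_apply h _ ⟨y, hy⟩]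
      refine (sumMap_apply h _ ((f s).symm ⟨y, hy⟩)).trans ?_
      simp)
    (linearMap_ext_of_isInternal h fun s y hy => by
      rw [LinearMap.comp_apply, sumMap_apply h _ ⟨y, hy⟩]
      refine (sumMap_apply h _ (f s ⟨y, hy⟩)).trans ?_
      simp)

theorem sumEquiv_apply (h : DirectSum.IsInternal A) (f : ∀ s, A s ≃ₗ[k] A s) {s : Fin ν}
    (y : A s) : sumEquiv h f y = f s y :=
  sumMap_apply h _ y

theorem sumEquiv_symm_apply (h : DirectSum.IsInternal A) (f : ∀ s, A s ≃ₗ[k] A s) {s : Fin ν}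
    (y : A s) : (sumEquiv h f).symm y = (f s).symm y :=
  sumMap_apply h _ y

end SumMap

namespace QRep

variable {I : Type u} [Quiver.{v} I] {k : Type w} [Field k]
variable {V : I → Type x} [∀ i, AddCommGroup (V i)] [∀ i, Module k (V i)]
variable {ν : ℕ} {M N : QRep k V} {Ns : Fin ν → N.Subrep}

/-! ### Filtrations and the points of the fibre -/

theorem Subrep.ext_carrier {A B : Subrep M} (h : A.carrier = B.carrier) : A = B := by
  cases A
  cases B
  cases h
  rfl

instance [Finite I] [∀ i, Finite (V i)] : Finite (Subrep M) :=
  Finite.of_injective (fun A : Subrep M => A.carrier) fun _ _ h => Subrep.ext_carrier h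

/-- `g` maps the filtration `F` onto the flag of the decomposition `V = ⊕_s V^s`. -/
def Adapted (D : Fin ν → ∀ i, Submodule k (V i)) (F : Fin (ν + 1) → Subrep M)
    (g : ∀ i, V i ≃ₗ[k] V i) : Prop :=
  ∀ (m : Fin (ν + 1)) (i : I) (y : V i), g i y ∈ flag D m.val i ↔ y ∈ (F m).carrier i

/-- The filtration is the preimage of the flag under `g`. Its steps are subrepresentations because
`g • M` preserves the flag, and `g` followed by the `s`-th projection identifies the subquotient
with `N_s` because `g • M` induces `N_s` there. -/
theorem exists_filtration (hD : ∀ i, DirectSum.IsInternal fun s => (Ns s).carrier i)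
    {g : ∀ i, V i ≃ₗ[k] V i} (hg : g • M ∈ fiberY (fun s => (Ns s).carrier) N) :
    ∃ F ∈ filtrations M fun s => (Ns s).toRep, Adapted (fun s => (Ns s).carrier) F g := by
  have hgM : ∀ ⦃i j : I⦄ (α : i ⟶ j) (y : V i), g j (M α y) = (g • M) α (g i y) := by
    intro i j α y
    rw [smul_apply, LinearEquiv.symm_apply_apply]
  let F : Fin (ν + 1) → Subrep M := fun m =>
    { carrier := fun i => (flag (fun s => (Ns s).carrier) m.val i).comap (g i).toLinearMap
      stable := fun i j α y hy => by
        have := hg.1 m.val α _ hy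
        simp only [Submodule.mem_comap, LinearEquiv.coe_coe] at this ⊢
        rwa [hgM] }
  refine ⟨F, ⟨fun i => ?_, fun i => ?_, fun s i y hy => ?_, fun s => ?_⟩,
    fun m i y => Iff.rfl⟩
  · exact eq_top_iff.2 fun y _ => mem_flag_zero hD i (g i y)
  · refine (Submodule.eq_bot_iff _).2 fun y hy => ?_
    have h : g i y ∈ flag (fun s => (Ns s).carrier) ν i := hy
    rw [flag_eq_bot i le_rfl, Submodule.mem_bot] at h
    exact (LinearEquiv.map_eq_zero_iff _).1 h
  · exact flag_anti (D := fun s => (Ns s).carrier) i (Nat.le_succ s.val) hy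
  · let f : ∀ i, (F s.castSucc).carrier i →ₗ[k] (Ns s).carrier i := fun i =>
      LinearMap.codRestrict _ (internalProj (hD i) s ∘ₗ (g i).toLinearMap ∘ₗ
        ((F s.castSucc).carrier i).subtype) fun y => internalProj_mem (hD i) s _
    have hker : ∀ i, ((F s.succ).carrier i).submoduleOf ((F s.castSucc).carrier i) =
        LinearMap.ker (f i) := by
      intro i
      ext y
      refine ((mem_flag_succ_iff hD s (y := g i y.1)).trans (and_iff_right y.2)).trans ?_
      rw [LinearMap.mem_ker, Subtype.ext_iff]
      exact Iff.rfl
    have hsurj : ∀ i, Function.Surjective (f i) := by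
      intro i y
      refine ⟨⟨(g i).symm y.1, ?_⟩, Subtype.ext ?_⟩
      · change g i ((g i).symm y.1) ∈ flag (fun s => (Ns s).carrier) s.val i
        rw [LinearEquiv.apply_symm_apply]
        exact le_flag (D := fun s => (Ns s).carrier) s le_rfl i y.2
      · change internalProj (hD i) s (g i ((g i).symm y.1)) = y.1
        rw [LinearEquiv.apply_symm_apply, internalProj_self (hD i) y.2]
    refine ⟨fun i => Submodule.quotEquivOfEq _ _ (hker i) ≪≫ₗ
      (f i).quotKerEquivOfSurjective (hsurj i), fun i j α => ?_⟩
    refine Submodule.linearMap_qext _ (LinearMap.ext fun y => Subtype.ext ?_)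
    change internalProj (hD j) s (g j (M α y.1)) = N α (internalProj (hD i) s (g i y.1))
    rw [hgM]
    have hy : g i y.1 ∈ flag (fun s => (Ns s).carrier) s.val i := y.2
    have h1 := hg.1 (s.val + 1) α _ (sub_internalProj_mem_flag hD s hy)
    have h2 := hg.2 s α _ (internalProj_mem (hD i) s (g i y.1))
    have h3 := Submodule.add_mem _ h1 h2
    rw [map_sub, sub_add_sub_cancel, mem_flag_succ_iff hD, map_sub, sub_eq_zero,
      internalProj_self (hD j) ((Ns s).stable α (internalProj_mem (hD i) s _))] at h3
    exact h3.2

/-- Over a field each surjection from a filtration step onto `N_s` splits linearly. The splittings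
glue to an automorphism of `V` taking the flag to the filtration, and `g` is its inverse. -/
theorem exists_adapted [∀ i, FiniteDimensional k (V i)]
    (hD : ∀ i, DirectSum.IsInternal fun s => (Ns s).carrier i)
    {F : Fin (ν + 1) → Subrep M} (hF : F ∈ filtrations M fun s => (Ns s).toRep) :
    ∃ g : ∀ i, V i ≃ₗ[k] V i, Adapted (fun s => (Ns s).carrier) F g ∧
      g • M ∈ fiberY (fun s => (Ns s).carrier) N := by
  obtain ⟨-, hbot, hstep, hiso⟩ := hF
  have hanti : ∀ (m n : Fin (ν + 1)) (i : I), m ≤ n → (F n).carrier i ≤ (F m).carrier i :=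
    fun m n i h => (Fin.antitone_iff_succ_le (f := fun m => (F m).carrier i)).2
      (fun s => hstep s i) h
  choose f hf using hiso
  let τ : ∀ s i, (F (Fin.castSucc s)).carrier i →ₗ[k] (Ns s).carrier i := fun s i =>
    (f s i).toLinearMap ∘ₗ Submodule.mkQ _
  have hτ0 : ∀ s i z, τ s i z = 0 ↔ z.1 ∈ (F s.succ).carrier i := by
    intro s i z
    refine ((f s i).map_eq_zero_iff).trans ?_
    exact Submodule.Quotient.mk_eq_zero _
  have hτM : ∀ s ⦃i j : I⦄ (α : i ⟶ j) z, (τ s j ((F s.castSucc).toRep α z) : V j) =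
      N α (τ s i z) := fun s i j α z =>
    congrArg Subtype.val (LinearMap.congr_fun (hf s α) (Submodule.Quotient.mk z))
  have hσ : ∀ s i, ∃ σ : (Ns s).carrier i →ₗ[k] (F (Fin.castSucc s)).carrier i,
      τ s i ∘ₗ σ = LinearMap.id := fun s i =>
    LinearMap.exists_rightInverse_of_surjective _
      (LinearMap.range_eq_top.2 ((f s i).surjective.comp (Submodule.mkQ_surjective _)))
  choose σ hσ using hσ
  replace hσ : ∀ s i y, τ s i (σ s i y) = y := fun s i => LinearMap.congr_fun (hσ s i)
  let h : ∀ i, V i →ₗ[k] V i := fun i =>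
    sumMap (hD i) fun s => ((F (Fin.castSucc s)).carrier i).subtype ∘ₗ σ s i
  have hh : ∀ s i (y : (Ns s).carrier i), h i y = σ s i y := fun s i y =>
    sumMap_apply (hD i) _ y
  have hmem : ∀ (m : Fin (ν + 1)) i z, z ∈ flag (fun s => (Ns s).carrier) m.val i →
      h i z ∈ (F m).carrier i := by
    intro m i z hz
    refine map_mem_of_forall_summand (h i) (fun s hs y hy => ?_) hz
    rw [hh s i ⟨y, hy⟩]
    exact hanti m s.castSucc i hs (σ s i ⟨y, hy⟩).2
  -- Descent along the flag: subtracting the part of `z` already in step `j + 1` leaves the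
  -- splitting applied to the `j`-th component, and `τ` recovers that component as zero.
  have hmem' : ∀ (m : Fin (ν + 1)) i z, h i z ∈ (F m).carrier i →
      z ∈ flag (fun s => (Ns s).carrier) m.val i := by
    intro m i z hz
    refine mem_flag_of_forall_lt hD fun j hj hzj => ?_
    have hjν : j < ν := by have := m.2; omega
    let s : Fin ν := ⟨j, hjν⟩
    refine (mem_flag_succ_iff hD s).2 ⟨hzj, ?_⟩
    have h1 := hmem s.succ i _ (sub_internalProj_mem_flag hD s hzj)
    have h2 := Submodule.sub_mem _ (hanti s.succ m i (Fin.le_def.2 hj) hz) h1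
    rw [map_sub, sub_sub_cancel, hh s i ⟨_, internalProj_mem (hD i) s z⟩, ← hτ0, hσ] at h2
    exact congrArg Subtype.val h2
  have hinj : ∀ i, Function.Injective (h i) := by
    intro i
    rw [← LinearMap.ker_eq_bot, LinearMap.ker_eq_bot']
    intro z hz
    have := hmem' (Fin.last ν) i z (by rw [hz]; exact Submodule.zero_mem _)
    rwa [Fin.val_last, flag_eq_bot i le_rfl, Submodule.mem_bot] at this
  let H : ∀ i, V i ≃ₗ[k] V i := fun i => LinearEquiv.ofInjectiveEndo (h i) (hinj i)
  have hH : ∀ i y, h i ((H i).symm y) = y := fun i y => (H i).apply_symm_apply y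
  have hadapt : ∀ (m : Fin (ν + 1)) i y,
      (H i).symm y ∈ flag (fun s => (Ns s).carrier) m.val i ↔ y ∈ (F m).carrier i := by
    intro m i y
    refine ⟨fun hy => ?_, fun hy => hmem' m i _ (by rwa [hH])⟩
    rw [← hH i y]
    exact hmem m i _ hy
  refine ⟨fun i => (H i).symm, hadapt, fun m i j α y hy => ?_, fun s i j α y hy => ?_⟩
  -- The flag is indexed by all naturals but the filtration only up to `ν`; beyond that the flag is
  -- zero.
  · rcases Nat.lt_or_ge m (ν + 1) with hm | hm
    · refine (hadapt ⟨m, hm⟩ j _).2 ((F ⟨m, hm⟩).stable α ?_)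
      exact hmem ⟨m, hm⟩ i y hy
    · rw [flag_eq_bot i (by omega), Submodule.mem_bot] at hy
      rw [hy, map_zero]
      exact Submodule.zero_mem _
  -- After applying `h` the claim becomes that `M (σ y)` and `σ (N y)` agree modulo the next
  -- filtration step; both have image `N y` under `τ`.
  · refine hmem' s.succ j _ ?_
    have h1 : (fun i => (H i).symm) j (M α (((fun i => (H i).symm) i).symm y)) =
      (H j).symm (M α (h i y)) := rfl
    rw [smul_apply, h1, map_sub, hH, hh s i ⟨y, hy⟩, hh s j ⟨N α y, (Ns s).stable α hy⟩]
    refine (hτ0 s j ((F s.castSucc).toRep α (σ s i ⟨y, hy⟩) -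
      σ s j ⟨N α y, (Ns s).stable α hy⟩)).1 ?_
    rw [map_sub, hσ, sub_eq_zero]
    refine Subtype.ext ?_
    rw [hτM, hσ]

/-! ### The Levi part -/

/-- The automorphism of `V = ⊕_s V^s` given by automorphisms of the `N_s`. -/
noncomputable def levi (hD : ∀ i, DirectSum.IsInternal fun s => (Ns s).carrier i)
    (a : ∀ s, (Ns s).toRep.Aut) : ∀ i, V i ≃ₗ[k] V i :=
  fun i => sumEquiv (hD i) fun s => (a s).1 i

theorem levi_apply (hD : ∀ i, DirectSum.IsInternal fun s => (Ns s).carrier i)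
    (a : ∀ s, (Ns s).toRep.Aut) {s : Fin ν} {i : I} (y : (Ns s).carrier i) :
    levi hD a i y = (a s).1 i y :=
  sumEquiv_apply (hD i) _ y

theorem levi_symm_mem (hD : ∀ i, DirectSum.IsInternal fun s => (Ns s).carrier i)
    (a : ∀ s, (Ns s).toRep.Aut) {s : Fin ν} {i : I} {y : V i} (hy : y ∈ (Ns s).carrier i) :
    (levi hD a i).symm y ∈ (Ns s).carrier i := by
  have := sumEquiv_symm_apply (hD i) (fun s => (a s).1 i) ⟨y, hy⟩
  rw [levi, this]
  exact Submodule.coe_mem _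

theorem levi_mem_flag_iff (hD : ∀ i, DirectSum.IsInternal fun s => (Ns s).carrier i)
    (a : ∀ s, (Ns s).toRep.Aut) (m : ℕ) (i : I) (y : V i) :
    levi hD a i y ∈ flag (fun s => (Ns s).carrier) m i ↔
      y ∈ flag (fun s => (Ns s).carrier) m i := by
  constructor
  · intro hy
    rw [← (levi hD a i).symm_apply_apply y]
    refine map_mem_of_forall_summand (levi hD a i).symm.toLinearMap (fun s hs z hz => ?_) hy
    exact le_flag (D := fun s => (Ns s).carrier) s hs i (levi_symm_mem hD a hz)
  · refine map_mem_of_forall_summand (levi hD a i).toLinearMap (fun s hs z hz => ?_)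
    refine le_flag (D := fun s => (Ns s).carrier) s hs i ?_
    rw [LinearEquiv.coe_coe, levi_apply hD a ⟨z, hz⟩]
    exact Submodule.coe_mem _

theorem mem_aut_iff {W : I → Type*} [∀ i, AddCommGroup (W i)] [∀ i, Module k (W i)]
    {X : QRep k W} {a : ∀ i, W i ≃ₗ[k] W i} :
    a ∈ X.Aut ↔ ∀ ⦃i j : I⦄ (α : i ⟶ j) (y : W i), a j (X α y) = X α (a i y) := by
  constructor
  · intro h i j α y
    have : (a • X) α (a i y) = X α (a i y) := by rw [show a • X = X from h]
    rwa [smul_apply, LinearEquiv.symm_apply_apply] at this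
  · intro h
    refine ext_apply fun i j α y => ?_
    change a j (X α ((a i).symm y)) = X α y
    rw [h, LinearEquiv.apply_symm_apply]

theorem levi_comm (hD : ∀ i, DirectSum.IsInternal fun s => (Ns s).carrier i)
    (a : ∀ s, (Ns s).toRep.Aut) ⦃i j : I⦄ (α : i ⟶ j) (y : V i) :
    levi hD a j (N α y) = N α (levi hD a i y) := by
  have : (levi hD a j).toLinearMap ∘ₗ N α = N α ∘ₗ (levi hD a i).toLinearMap := by
    refine linearMap_ext_of_isInternal (hD i) fun s z hz => ?_
    simp only [LinearMap.comp_apply, LinearEquiv.coe_coe]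
    rw [levi_apply hD a ⟨z, hz⟩, levi_apply hD a ⟨N α z, (Ns s).stable α hz⟩]
    exact congrArg Subtype.val (mem_aut_iff.1 (a s).2 α ⟨z, hz⟩)
  exact LinearMap.congr_fun this y

/-- The Levi element commutes with `N` and preserves the flag, the two data that define the fibre.
-/
theorem levi_smul_mem_fiberY (hD : ∀ i, DirectSum.IsInternal fun s => (Ns s).carrier i)
    (a : ∀ s, (Ns s).toRep.Aut) {X : QRep k V} (hX : X ∈ fiberY (fun s => (Ns s).carrier) N) :
    levi hD a • X ∈ fiberY (fun s => (Ns s).carrier) N := by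
  refine ⟨fun m i j α y hy => ?_, fun s i j α y hy => ?_⟩
  · rw [smul_apply, levi_mem_flag_iff]
    refine hX.1 m α _ ?_
    rwa [← levi_mem_flag_iff hD a, LinearEquiv.apply_symm_apply]
  · have h := hX.2 s α _ (levi_symm_mem hD a hy)
    rw [← levi_mem_flag_iff hD a, map_sub, levi_comm, LinearEquiv.apply_symm_apply] at h
    exact h

/-! ### Counting -/

/-- Elements of `∏_i GL(V_i)` moving `M` into the fibre and adapted to the same filtration differ
by an element of the unipotent radical and automorphisms of the subquotients. -/
theorem exists_mul_levi [∀ i, FiniteDimensional k (V i)]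
    (hD : ∀ i, DirectSum.IsInternal fun s => (Ns s).carrier i) {F : Fin (ν + 1) → Subrep M}
    {g h : ∀ i, V i ≃ₗ[k] V i} (hgF : Adapted (fun s => (Ns s).carrier) F g)
    (hhF : Adapted (fun s => (Ns s).carrier) F h)
    (hg : g • M ∈ fiberY (fun s => (Ns s).carrier) N)
    (hh : h • M ∈ fiberY (fun s => (Ns s).carrier) N) :
    ∃ u ∈ unipotentRadical (fun s => (Ns s).carrier) hD, ∃ a : ∀ s, (Ns s).toRep.Aut,
      u * levi hD a * h = g := by
  -- `q` preserves the flag and carries `h • M` to `g • M`. Its diagonal blocks `b` supply the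
  -- automorphisms of the `N_s`, and what remains is unipotent.
  set q : ∀ i, V i ≃ₗ[k] V i := g * h⁻¹ with hq
  have hqa : ∀ i y, q i y = g i ((h i).symm y) := fun _ _ => rfl
  have hqX : ∀ ⦃i j : I⦄ (α : i ⟶ j) (y : V i), q j ((h • M) α y) = (g • M) α (q i y) := by
    intro i j α y
    simp only [smul_apply, hqa, LinearEquiv.symm_apply_apply]
  have hqm : ∀ m ≤ ν, ∀ i y, q i y ∈ flag (fun s => (Ns s).carrier) m i ↔
      y ∈ flag (fun s => (Ns s).carrier) m i := by
    intro m hm i y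
    have h1 := hgF ⟨m, Nat.lt_succ_of_le hm⟩ i ((h i).symm y)
    have h2 := hhF ⟨m, Nat.lt_succ_of_le hm⟩ i ((h i).symm y)
    rw [LinearEquiv.apply_symm_apply] at h2
    exact h1.trans h2.symm
  let b : ∀ s i, (Ns s).carrier i →ₗ[k] (Ns s).carrier i := fun s i =>
    LinearMap.codRestrict _ (internalProj (hD i) s ∘ₗ (q i).toLinearMap ∘ₗ
      ((Ns s).carrier i).subtype) fun y => internalProj_mem (hD i) s _
  have hb : ∀ s i y, (b s i y : V i) = internalProj (hD i) s (q i y) := fun _ _ _ => rfl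
  have hqs : ∀ s i (y : (Ns s).carrier i), q i y ∈ flag (fun s => (Ns s).carrier) s.val i :=
    fun s i y => (hqm s.val s.2.le i y).2 (le_flag (D := fun s => (Ns s).carrier) s le_rfl i y.2)
  have hbinj : ∀ s i, Function.Injective (b s i) := by
    intro s i
    rw [← LinearMap.ker_eq_bot, LinearMap.ker_eq_bot']
    intro y hy
    have h1 : internalProj (hD i) s (q i y) = 0 := by rw [← hb, hy]; rfl
    have h2 := (hqm (s.val + 1) s.2 i y).1 ((mem_flag_succ_iff hD s).2 ⟨hqs s i y, h1⟩)
    have h3 := ((mem_flag_succ_iff hD s).1 h2).2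
    rw [internalProj_self (hD i) y.2] at h3
    exact Subtype.ext h3
  let a : ∀ s, (Ns s).toRep.Aut := fun s =>
    ⟨fun i => LinearEquiv.ofInjectiveEndo (b s i) (hbinj s i), mem_aut_iff.2 fun i j α y => by
      refine Subtype.ext ?_
      change internalProj (hD j) s (q j (N α y)) = N α (internalProj (hD i) s (q i y))
      -- Modulo the next step of the flag both `h • M` and `g • M` act on `V^s` as `N`, so the
      -- intertwiner `q` becomes an endomorphism of `N_s`.
      have h1 := (hqm (s.val + 1) s.2 j _).2 (hh.2 s α y y.2)
      have h2 := hg.1 (s.val + 1) α _ (sub_internalProj_mem_flag hD s (hqs s i y))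
      have h3 := hg.2 s α _ (internalProj_mem (hD i) s (q i y))
      rw [map_sub, hqX] at h1
      rw [map_sub] at h2
      have h4 := Submodule.sub_mem _ (Submodule.add_mem _ h2 h3) h1
      rw [sub_add_sub_cancel, sub_sub_sub_cancel_left, mem_flag_succ_iff hD, map_sub,
        sub_eq_zero,
        internalProj_self (hD j) ((Ns s).stable α (internalProj_mem (hD i) s _))] at h4
      exact h4.2⟩
  have ha : ∀ s i (y : (Ns s).carrier i), levi hD a i y = internalProj (hD i) s (q i y) :=
    fun s i y => levi_apply hD a y
  refine ⟨q * (levi hD a)⁻¹, fun m i y hy => ?_, a, by rw [inv_mul_cancel_right, hq,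
    inv_mul_cancel_right]⟩
  refine map_mem_of_forall_summand
    ((q i).toLinearMap ∘ₗ (levi hD a i).symm.toLinearMap - LinearMap.id) (fun s hs z hz => ?_) hy
  have hz' := levi_symm_mem hD a hz
  have h1 := sub_internalProj_mem_flag hD s (hqs s i ⟨_, hz'⟩)
  rw [← ha, LinearEquiv.apply_symm_apply] at h1
  exact flag_anti (D := fun s => (Ns s).carrier) i (by omega) h1

theorem adapted_mul_levi (hD : ∀ i, DirectSum.IsInternal fun s => (Ns s).carrier i)
    {F : Fin (ν + 1) → Subrep M} {g u : ∀ i, V i ≃ₗ[k] V i}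
    (hg : Adapted (fun s => (Ns s).carrier) F g)
    (hu : u ∈ unipotentRadical (fun s => (Ns s).carrier) hD) (a : ∀ s, (Ns s).toRep.Aut) :
    Adapted (fun s => (Ns s).carrier) F (u * levi hD a * g) := by
  intro m i y
  refine Iff.trans ?_ (hg m i y)
  exact (mem_flag_iff_of_mem_unipotentRadical hD hu m i _).trans (levi_mem_flag_iff hD a m i _)

theorem Adapted.unique {D : Fin ν → ∀ i, Submodule k (V i)} {F F' : Fin (ν + 1) → Subrep M}
    {g : ∀ i, V i ≃ₗ[k] V i} (h : Adapted D F g) (h' : Adapted D F' g) : F = F' := by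
  funext m
  refine Subrep.ext_carrier (funext fun i => ?_)
  ext y
  exact (h m i y).symm.trans (h' m i y)

/-- The diagonal blocks of `u * levi hD a` are the `a s`, since `u` is the identity on subquotients;
then `u` is recovered by cancellation. -/
theorem mul_levi_injective (hD : ∀ i, DirectSum.IsInternal fun s => (Ns s).carrier i)
    {u u' : ∀ i, V i ≃ₗ[k] V i} (hu : u ∈ unipotentRadical (fun s => (Ns s).carrier) hD)
    (hu' : u' ∈ unipotentRadical (fun s => (Ns s).carrier) hD) {a a' : ∀ s, (Ns s).toRep.Aut}
    (h : u * levi hD a = u' * levi hD a') : u = u' ∧ a = a' := by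
  have key : ∀ {u : ∀ i, V i ≃ₗ[k] V i}, u ∈ unipotentRadical (fun s => (Ns s).carrier) hD →
      ∀ (a : ∀ s, (Ns s).toRep.Aut) s i (y : (Ns s).carrier i),
      internalProj (hD i) s ((u * levi hD a) i y) = (a s).1 i y := by
    intro u hu a s i y
    have h1 : (u * levi hD a) i y = u i ((a s).1 i y) := by
      rw [← levi_apply hD a y]
      rfl
    have h2 := hu s.val i ((a s).1 i y)
      (le_flag (D := fun s => (Ns s).carrier) s le_rfl i (Submodule.coe_mem _))
    have h3 := ((mem_flag_succ_iff hD s).1 h2).2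
    rwa [map_sub, internalProj_self (hD i) (Submodule.coe_mem _), sub_eq_zero, ← h1] at h3
  have haa : a = a' := by
    funext s
    refine Subtype.ext (funext fun i => LinearEquiv.ext fun y => Subtype.ext ?_)
    rw [← key hu a s i y, ← key hu' a' s i y, h]
  subst haa
  exact ⟨mul_right_cancel h, rfl⟩

/-- The group elements moving `M` into the fibre are fibred over the filtrations of `M`. -/
theorem card_smul_mem_fiberY [∀ i, FiniteDimensional k (V i)]
    (hD : ∀ i, DirectSum.IsInternal fun s => (Ns s).carrier i) (M : QRep k V) :
    Nat.card {g : ∀ i, V i ≃ₗ[k] V i // g • M ∈ fiberY (fun s => (Ns s).carrier) N} =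
      (filtrations M fun s => (Ns s).toRep).ncard *
        (Nat.card (unipotentRadical (fun s => (Ns s).carrier) hD) *
          ∏ s, Nat.card (Ns s).toRep.Aut) := by
  -- A base point `c F` over each filtration; every other element over `F` is uniquely `u * levi hD
  -- a * c F`.
  choose c hcF hcY using fun F : filtrations M fun s => (Ns s).toRep => exists_adapted hD F.2
  rw [← Nat.card_pi, ← Nat.card_prod, ← Nat.card_coe_set_eq, ← Nat.card_prod]
  symm
  refine Nat.card_congr (Equiv.ofBijective
    (fun p : (filtrations M fun s => (Ns s).toRep) ×
        unipotentRadical (fun s => (Ns s).carrier) hD × ∀ s, (Ns s).toRep.Aut =>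
      (⟨p.2.1.1 * levi hD p.2.2 * c p.1, by
        rw [mul_smul, mul_smul]
        exact smul_mem_fiberY hD p.2.1.2 (levi_smul_mem_fiberY hD p.2.2 (hcY p.1))⟩ :
        {g : ∀ i, V i ≃ₗ[k] V i // g • M ∈ fiberY (fun s => (Ns s).carrier) N})) ⟨?_, ?_⟩)
  · rintro ⟨F, u, a⟩ ⟨F', u', a'⟩ h
    have h1 : u.1 * levi hD a * c F = u'.1 * levi hD a' * c F' := congrArg Subtype.val h
    have h2 := adapted_mul_levi hD (hcF F) u.2 a
    rw [h1] at h2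
    have h3 : F = F' := Subtype.ext (h2.unique (adapted_mul_levi hD (hcF F') u'.2 a'))
    subst h3
    obtain ⟨h4, h5⟩ := mul_levi_injective hD u.2 u'.2 (mul_right_cancel h1)
    rw [Subtype.ext h4, h5]
  · rintro ⟨g, hg⟩
    obtain ⟨F, hF, hgF⟩ := exists_filtration hD hg
    obtain ⟨u, hu, a, h⟩ := exists_mul_levi hD hgF (hcF ⟨F, hF⟩) hg (hcY ⟨F, hF⟩)
    exact ⟨(⟨F, hF⟩, ⟨u, hu⟩, a), Subtype.ext h⟩

/-! ### Homomorphisms between sums of copies -/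

/-- If `Hom(X, Y) = 0`, then there are no nonzero homomorphisms between sums of copies of `X`
and of `Y`. -/
theorem HomZero.of_isIso_power {V₁ V₂ W₁ W₂ : I → Type*} [∀ i, AddCommGroup (V₁ i)]
    [∀ i, Module k (V₁ i)] [∀ i, AddCommGroup (V₂ i)] [∀ i, Module k (V₂ i)]
    [∀ i, AddCommGroup (W₁ i)] [∀ i, Module k (W₁ i)] [∀ i, AddCommGroup (W₂ i)]
    [∀ i, Module k (W₂ i)] {X : QRep k V₁} {Y : QRep k V₂} {A : QRep k W₁} {B : QRep k W₂}
    (h : X.HomZero Y) {m n : ℕ} (hA : A.IsIso (X.power m)) (hB : B.IsIso (Y.power n)) :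
    A.HomZero B := by
  obtain ⟨a, ha⟩ := hA
  obtain ⟨b, hb⟩ := hB
  intro f hf i
  -- The matrix entries of `f`, read through the two isomorphisms, are morphisms `X → Y`, hence
  -- zero.
  have key : ∀ (p : Fin m) (q : Fin n) i (y : V₁ i),
      b i (f i ((a i).symm (Pi.single p y))) q = 0 := by
    intro p q i y
    refine LinearMap.congr_fun (h (fun i => LinearMap.proj q ∘ₗ (b i).toLinearMap ∘ₗ f i ∘ₗ
      (a i).symm.toLinearMap ∘ₗ LinearMap.single k (fun _ => V₁ i) p) (fun i j α => ?_) i) y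
    ext z
    have h1 : (a j).symm (Pi.single p (X α z)) = A α ((a i).symm (Pi.single p z)) := by
      rw [LinearEquiv.symm_apply_eq]
      refine Eq.trans ?_ (LinearMap.congr_fun (ha α) ((a i).symm (Pi.single p z))).symm
      change _ = X.power m α (a i ((a i).symm (Pi.single p z)))
      rw [LinearEquiv.apply_symm_apply]
      funext r
      change _ = X α ((Pi.single p z : Fin m → V₁ i) r)
      rcases eq_or_ne r p with rfl | hr
      · simp
      · simp [hr]
    have h2 := LinearMap.congr_fun (hf α) ((a i).symm (Pi.single p z))
    have h3 := LinearMap.congr_fun (hb α) (f i ((a i).symm (Pi.single p z)))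
    change b j (f j ((a j).symm (Pi.single p (X α z)))) q =
      Y α (b i (f i ((a i).symm (Pi.single p z))) q)
    rw [h1]
    exact (congrArg (fun w => b j w q) h2).trans (congrFun h3 q)
  ext y
  have h1 : a i y = ∑ p, Pi.single p (a i y p) := (Finset.univ_sum_single _).symm
  rw [← (a i).symm_apply_apply y, h1, map_sum, map_sum]
  refine Finset.sum_eq_zero fun p _ => ?_
  rw [← (b i).map_eq_zero_iff]
  exact funext fun q => key p q i _

end QRep

/-! ### The counting formula -/

theorem IsDynkinQuiver.finite {I : Type u} [Quiver.{v} I] (h : IsDynkinQuiver I) : Finite I := by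
  obtain ⟨-, c, n, T, e, -⟩ := h
  exact Finite.of_equiv _ e.symm

theorem corollary2p6 {I : Type*} [Quiver I] (hQ : IsDynkinQuiver I)
    {k : Type*} [Field k] [Finite k]
    -- the indecomposable representations, ordered directedly
    {ν : ℕ} {e : Fin ν → I → ℕ} (J : ∀ s, RepVar k (e s))
    (hJ : QRep.IsListOfIndecomposables J)
    (hdir : ∀ s t : Fin ν, s < t → (J s).HomZero (J t))
    -- `N = ⊕ N_s` with `N_s` isomorphic to a direct sum of copies of `J_s`
    {d : I → ℕ} (M N : RepVar k d) (Ns : Fin ν → N.Subrep)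
    (hNs : ∀ i, DirectSum.IsInternal fun s => (Ns s).carrier i)
    (hiso : ∀ s, ∃ n : ℕ, (Ns s).toRep.IsIso ((J s).power n))
    -- the complement defining the slice `E_N`
    (E : Submodule k (RepVar k d))
    (hE : QRep.IsGradedComplement (fun s => (Ns s).carrier) N E) :
    (QRep.filtrations M fun s => (Ns s).toRep).Finite ∧
    ((QRep.filtrations M fun s => (Ns s).toRep).ncard : ℚ) =
      ((Nat.card M.Aut : ℚ) * ((QRep.slice N E ∩ M.orbit).ncard : ℚ)) /
        ∏ s, (Nat.card (Ns s).toRep.Aut : ℚ) := by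
  have := hQ.finite
  have := hQ.1
  have hNs' : ∀ i, DirectSum.IsInternal fun s => (Ns s).carrier i := hNs
  refine ⟨Set.toFinite _, ?_⟩
  have hhom : ∀ s t, s < t → (Ns s).toRep.HomZero (Ns t).toRep := fun s t hst =>
    (hdir s t hst).of_isIso_power (hiso s).choose_spec (hiso t).choose_spec
  -- The double count: the left side is rewritten by filtrations, the right side by points of the
  -- slice, and the common factor `|U|` is moved to the front of both.
  have h1 := QRep.card_smul_mem M (QRep.fiberY (fun s => (Ns s).carrier) N)
  rw [QRep.card_smul_mem_fiberY hNs', QRep.ncard_fiberY_inter_orbit hNs' (fun _ => rfl) hhom hE,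
    mul_left_comm, mul_left_comm (Nat.card M.Aut)] at h1
  have hU : 0 < Nat.card (QRep.unipotentRadical (fun s => (Ns s).carrier) hNs') := Nat.card_pos
  have h2 := Nat.eq_of_mul_eq_mul_left hU h1
  have hA : (∏ s, (Nat.card (Ns s).toRep.Aut : ℚ)) ≠ 0 :=
    Finset.prod_ne_zero_iff.2 fun s _ => Nat.cast_ne_zero.2 Nat.card_pos.ne'
  rw [eq_div_iff hA]
  exact_mod_cast h2
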